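/- Let $N\ge 0$ be an integer, let $\mathscr M(\mathbb R^N)$ be the space of finite signed Borel measures on $\mathbb R^N$, and let $H:\mathbb R^N\times\mathbb R\to[0,+\infty]$ be a function such that $H(x,0)=0$ for every $x$ and such that, for every $x$, $m\mapsto H(x,m)$ is concave on $(0,+\infty)$ and on $(-\infty,0)$. Let $$H_{\mathrm{lsc}}(x,m)=\sup\{G(x,m)\;:\;G:\mathbb R^N\times\mathbb R\to[0,+\infty]\text{ lower semicontinuous},\ G\le H\}$$ be the lower semicontinuous envelope of $H$. For $u\in\mathscr M(\mathbb R^N)$ put $$\mathbf M^H_{\mathrm{atom}}(u)=\begin{cases}\sum_{i=1}^kH(x_i,m_i)&\text{if }u=\sum_{i=1}^km_i\delta_{x_i}\text{ with finitely many distinct points }x_i\in\mathbb R^N\text{ and }m_i\in\mathbb R,\\+\infty&\text{otherwise.}\end{cases}$$ For a Borel function $K:\mathbb R^N\times\mathbb R\to[0,+\infty]$ whose slopes $K'(x,0^\pm)=\lim_{m\to0^\pm}K(x,m)/|m|\in[0,+\infty]$ exist for every $x$, put $$\mathbf M^K(u)=\sum_{x\in\mathbb R^N}K(x,u(\{x\}))+\int_{\mathbb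 R^N}K'(x,0^+)\,du^d_+(x)+\int_{\mathbb R^N}K'(x,0^-)\,du^d_-(x),$$ where $u^d$ is the diffuse (non-atomic) part of $u$ and $u^d=u^d_+-u^d_-$ is its Jordan decomposition. A functional $F:\mathscr M(\mathbb R^N)\to[0,+\infty]$ is called sequentially narrowly lower semicontinuous if $F(u)\le\liminf_{n\to\infty}F(u_n)$ whenever $\int f\,du_n\to\int f\,du$ for every bounded continuous $f:\mathbb R^N\to\mathbb R$. Then $H_{\mathrm{lsc}}$ is Borel and its slopes $H_{\mathrm{lsc}}'(x,0^\pm)$ exist in $[0,+\infty]$ for every $x$, so that $\mathbf M^{H_{\mathrm{lsc}}}$ is well defined, and $\mathbf M^{H_{\mathrm{lsc}}}$ is the sequentially narrowly lower semicontinuous envelope of $\mathbf M^H_{\mathrm{atom}}$: for every $u\in\mathscr M(\mathbb R^N)$, $$\mathbf M^{H_{\mathrm{lsc}}}(u)=\sup\bigl\{F(u)\;:\;F:\mathscr M(\mathbb R^N)\to[0,+\infty]\text{ sequentially narrowly lower semicontinuous},\ F\le\mathbf M^H_{\mathrm{atom}}\bigr\}.$$ -/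

import Mathlib

open Filter Topology MeasureTheory Set
open scoped ENNReal NNReal BoundedContinuousFunction

noncomputable section

namespace HMass

/-- Euclidean space `ℝ^N`. -/
abbrev E (N : ℕ) : Type := EuclideanSpace ℝ (Fin N)

/-- `H : ℝ^N × ℝ → [0,+∞]` is mass-concave if, for every `x`, the function `H (x, ·)` is concave
on `(0,+∞)` and on `(-∞,0)`. (`[0,+∞]` carries an action of the nonnegative reals, so the
coefficients of the convex combinations are taken in `ℝ≥0`.) -/
def MassConcave {N : ℕ} (H : E N × ℝ → ℝ≥0∞) : Prop :=
  ∀ x, ConcaveOn ℝ≥0 (Ioi (0 : ℝ)) (fun m => H (x, m)) ∧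
    ConcaveOn ℝ≥0 (Iio (0 : ℝ)) (fun m => H (x, m))

/-- The lower semicontinuous envelope of `H`: the supremum of its lower semicontinuous
minorants. -/
def lscEnvelope {N : ℕ} (H : E N × ℝ → ℝ≥0∞) : E N × ℝ → ℝ≥0∞ :=
  sSup {G | G ≤ H ∧ LowerSemicontinuous G}

/-- The right slope `H'(x,0⁺) = lim_{m → 0⁺} H(x,m)/|m|`. -/
def rightSlope {N : ℕ} (H : E N × ℝ → ℝ≥0∞) (x : E N) : ℝ≥0∞ :=
  limUnder (𝓝[>] (0 : ℝ)) fun m => H (x, m) / ENNReal.ofReal |m|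

/-- The left slope `H'(x,0⁻) = lim_{m → 0⁻} H(x,m)/|m|`. -/
def leftSlope {N : ℕ} (H : E N × ℝ → ℝ≥0∞) (x : E N) : ℝ≥0∞ :=
  limUnder (𝓝[<] (0 : ℝ)) fun m => H (x, m) / ENNReal.ofReal |m|

/-- The conditions under which the `H`-mass is defined: `H` is Borel and both slopes at the origin
exist in `[0,+∞]`. -/
structure IsAdmissible {N : ℕ} (H : E N × ℝ → ℝ≥0∞) : Prop where
  measurable : Measurable H
  tendsto_rightSlope : ∀ x, Tendsto (fun m => H (x, m) / ENNReal.ofReal |m|)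
    (𝓝[>] (0 : ℝ)) (𝓝 (rightSlope H x))
  tendsto_leftSlope : ∀ x, Tendsto (fun m => H (x, m) / ENNReal.ofReal |m|)
    (𝓝[<] (0 : ℝ)) (𝓝 (leftSlope H x))

/-- The set of atoms of a finite signed Borel measure. -/
def atoms {N : ℕ} (u : SignedMeasure (E N)) : Set (E N) := {x | u {x} ≠ 0}

theorem countable_atoms {N : ℕ} (u : SignedMeasure (E N)) : (atoms u).Countable := by
  have h := Measure.countable_meas_pos_of_disjoint_iUnion (μ := u.totalVariation)
    (As := fun x : E N => ({x} : Set (E N))) (fun x => measurableSet_singleton x)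
    (fun x y hxy => by simpa [Function.onFun] using hxy)
  refine h.mono fun x hx => ?_
  have h1 := u.enorm_le_totalVariation {x}
  exact lt_of_lt_of_le (enorm_pos.2 hx) h1

theorem measurableSet_atoms {N : ℕ} (u : SignedMeasure (E N)) : MeasurableSet (atoms u) :=
  (countable_atoms u).measurableSet

/-- The diffuse part `u^d` of `u`: its restriction to the complement of the (countable, hence
measurable) set of atoms. The atomic part `u^a = u - u^d` is the restriction to the atoms. -/
def diffusePart {N : ℕ} (u : SignedMeasure (E N)) : SignedMeasure (E N) :=
  u.restrict (atoms u)ᶜ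

/-- The `H`-mass `∫ H(x,u({x})) dℋ⁰(x) + ∫ H'(x,0⁺) du^d_+(x) + ∫ H'(x,0⁻) du^d_-(x)` of a finite
signed Borel measure `u`, where `ℋ⁰` is the counting measure and `u^d = u^d_+ - u^d_-` is the
Jordan decomposition of the diffuse part. -/
def massH {N : ℕ} (H : E N × ℝ → ℝ≥0∞) (u : SignedMeasure (E N)) : ℝ≥0∞ :=
  ∫⁻ x, H (x, u {x}) ∂Measure.count
    + ∫⁻ x, rightSlope H x ∂(diffusePart u).toJordanDecomposition.posPart
    + ∫⁻ x, leftSlope H x ∂(diffusePart u).toJordanDecomposition.negPart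

/-- The atomic functional: `∑ i, H (x_i, m_i)` if `u = ∑ i, m_i δ_{x_i}` for finitely many distinct
points `x_i` and reals `m_i`, and `+∞` (the infimum over the empty set) if `u` is not of this form.
Two such representations of `u` differ only by terms with `m_i = 0`, so for `H(·,0) = 0` the value
does not depend on the representation, see `massAtom_sum_dirac`. -/
def massAtom {N : ℕ} (H : E N × ℝ → ℝ≥0∞) (u : SignedMeasure (E N)) : ℝ≥0∞ :=
  ⨅ (s : Finset (E N)) (m : E N → ℝ) (_ : u = ∑ x ∈ s, VectorMeasure.dirac x (m x)),
    ∑ x ∈ s, H (x, m x)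

theorem sum_dirac_singleton {N : ℕ} (s : Finset (E N)) (m : E N → ℝ) (y : E N) :
    (∑ x ∈ s, VectorMeasure.dirac x (m x) : SignedMeasure (E N)) {y}
      = (s : Set (E N)).indicator m y := by
  classical
  have h : ∀ x ∈ s, (VectorMeasure.dirac x (m x) : SignedMeasure (E N)) {y}
      = if x = y then m y else 0 := by
    intro x _
    split_ifs with hxy
    · subst hxy
      exact VectorMeasure.dirac_apply_of_mem (measurableSet_singleton _) (mem_singleton _)
    · exact VectorMeasure.dirac_apply_of_notMem (by simpa using hxy)
  simp only [_root_.sum_apply, indicator, Finset.mem_coe]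
  rw [Finset.sum_congr rfl h, Finset.sum_ite_eq' s y]

theorem massAtom_sum_dirac {N : ℕ} (H : E N × ℝ → ℝ≥0∞) (H0 : ∀ x, H (x, 0) = 0)
    (s : Finset (E N)) (m : E N → ℝ) :
    massAtom H (∑ x ∈ s, VectorMeasure.dirac x (m x)) = ∑ x ∈ s, H (x, m x) := by
  have key : ∀ (s : Finset (E N)) (m : E N → ℝ), ∑ x ∈ s, H (x, m x)
      = ∑' y, H (y, (∑ x ∈ s, VectorMeasure.dirac x (m x) : SignedMeasure (E N)) {y}) := by
    intro s m
    rw [tsum_eq_sum (s := s)]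
    · refine Finset.sum_congr rfl fun x hx => ?_
      rw [sum_dirac_singleton, indicator_of_mem (by simpa using hx)]
    · intro x hx
      rw [sum_dirac_singleton, indicator_of_notMem (by simpa using hx), H0]
  refine le_antisymm (iInf_le_of_le s <| iInf_le_of_le m <| iInf_le_of_le rfl le_rfl) ?_
  refine le_iInf fun t => le_iInf fun n => le_iInf fun h => ?_
  rw [key s m, key t n, h]

/-- Narrow convergence of a sequence of finite signed measures: convergence in duality with the
bounded continuous functions. -/
def NarrowTendsto {N : ℕ} (v : ℕ → SignedMeasure (E N)) (u : SignedMeasure (E N)) : Prop :=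
  ∀ f : E N →ᵇ ℝ, Tendsto (fun n => ∫ᵛ x, f x ∂<•(v n)) atTop (𝓝 (∫ᵛ x, f x ∂<•u))

/-- Sequential lower semicontinuity with respect to narrow convergence. -/
def SeqNarrowLsc {N : ℕ} (F : SignedMeasure (E N) → ℝ≥0∞) : Prop :=
  ∀ (v : ℕ → SignedMeasure (E N)) (u : SignedMeasure (E N)), NarrowTendsto v u →
    F u ≤ liminf (fun n => F (v n)) atTop

/-- The sequentially narrowly lower semicontinuous envelope of a functional: the supremum of its
sequentially narrowly lower semicontinuous minorants. -/
def seqNarrowLscEnvelope {N : ℕ} (Φ : SignedMeasure (E N) → ℝ≥0∞) :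
    SignedMeasure (E N) → ℝ≥0∞ :=
  sSup {F | F ≤ Φ ∧ SeqNarrowLsc F}

end HMass

end

/-! Write K for `lscEnvelope H`. Concavity of `H` enters only through ray-concavity, a K(x,m) ≤
K(x,lm) for a ≤ min(1,l), which passes to the envelope and yields all that is needed: monotonicity
and subadditivity in the mass, and slopes K(x,m)/|m| that increase as m tends to 0 from either side.

The mass of K is itself an admissible competitor. It is at most `massAtom H` on finitely atomic
measures, and its lower semicontinuity is the main work. The mass splits over the Jordan parts, so
by reflection only positive parts matter. The mass of the positive part μ of u is at most ∫ sup
c·1_A dμ, the supremum being over countably many adapted pairs: A is open and some t > μ(A)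
satisfies K(·,t) ≥ ct on A (`posMass_le_lintegral`). Finitely many such pairs, cut to disjoint Borel
sets, nearly exhaust the integral. Test functions with disjoint supports then localise the
convergence, and on each open support U the bound c·min(ν(U), t) ≤ mass of ν on U
(`mul_min_le_posMass`) gives the inequality, because the truncation at t is inactive in the limit.

Conversely, let F be lower semicontinuous and below `massAtom H`. Moving each atom (x,m) along a
sequence that recovers K(x,m) shows that F is below `massAtom` of K (`le_massAtom_lscEnvelope`).
Every u is a narrow limit of finitely atomic measures whose `massAtom` for K does not exceed its
K-mass (`atomApprox_massH`): truncate the atomic part, and concentrate the diffuse parts at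
well-chosen points of small cells. Hence F is below the K-mass. -/

noncomputable section

namespace HMass

variable {N : ℕ}

/-! ### Ray-concave functions -/

/-- The consequences of mass-concavity that pass to the lower semicontinuous envelope:
`H (x, 0) = 0`, and along every ray `H (x, ·)` is nondecreasing while its slope is nonincreasing. -/
structure IsRayConcave (K : E N × ℝ → ℝ≥0∞) : Prop where
  zero : ∀ x, K (x, 0) = 0
  scale : ∀ x m (a l : ℝ≥0), a ≤ 1 → a ≤ l → (a : ℝ≥0∞) * K (x, m) ≤ K (x, l * m)

/-- For b < a, m' is a convex combination of m with weight b and of a second point, which is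
positive because bm < m'. Concavity gives the bound with b once the nonnegative term at the second
point is dropped. Taking b strictly below a keeps that point well defined even when a = 1 or am =
m'. -/
theorem mul_le_of_concaveOn_Ioi {f : ℝ → ℝ≥0∞} (hf : ConcaveOn ℝ≥0 (Ioi (0 : ℝ)) f)
    {m m' : ℝ} (hm : 0 < m) {a : ℝ≥0} (ha : a ≤ 1) (ham : a * m ≤ m') :
    (a : ℝ≥0∞) * f m ≤ f m' := by
  refine ENNReal.mul_le_of_forall_lt fun b hb c hc => ?_
  lift b to ℝ≥0 using (hb.trans_le le_top).ne
  have hba : b < a := by exact_mod_cast hb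
  have hb1 : (b : ℝ) < 1 := by exact_mod_cast hba.trans_le ha
  have hpos : 0 < m' - b * m := by
    have : (b : ℝ) < a := by exact_mod_cast hba
    nlinarith
  have hy : (m' - b * m) / (1 - b) ∈ Ioi (0 : ℝ) := div_pos hpos (by linarith)
  have hb1' : b ≤ 1 := by exact_mod_cast hb1.le
  have key := hf.2 (mem_Ioi.2 hm) hy zero_le zero_le (add_tsub_cancel_of_le hb1')
  have hcomb : b • m + (1 - b) • ((m' - b * m) / (1 - b)) = m' := by
    have : ((1 - b : ℝ≥0) : ℝ) = 1 - b := by rw [NNReal.coe_sub hb1']; simp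
    simp only [NNReal.smul_def, this, smul_eq_mul]
    field_simp [show (1 : ℝ) - b ≠ 0 by linarith]
    ring
  rw [hcomb] at key
  calc (b : ℝ≥0∞) * c ≤ b * f m := by gcongr
    _ = b • f m := rfl
    _ ≤ b • f m + (1 - b) • f ((m' - b * m) / (1 - b)) := le_self_add
    _ ≤ f m' := key

/-- The reflection `(x, m) ↦ K (x, -m)`. -/
def reflect (K : E N × ℝ → ℝ≥0∞) : E N × ℝ → ℝ≥0∞ := fun p => K (p.1, -p.2)

theorem MassConcave.reflect {H : E N × ℝ → ℝ≥0∞} (hH : MassConcave H) :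
    MassConcave (reflect H) := by
  have aux : ∀ {s t : Set ℝ} {f : ℝ → ℝ≥0∞}, ConcaveOn ℝ≥0 s f → Convex ℝ≥0 t →
      (∀ m ∈ t, -m ∈ s) → ConcaveOn ℝ≥0 t fun m => f (-m) := by
    intro s t f hf ht hts
    refine ⟨ht, fun m hm n hn a b ha hb hab => ?_⟩
    have := hf.2 (hts m hm) (hts n hn) ha hb hab
    rwa [show a • -m + b • -n = -(a • m + b • n) by rw [smul_neg, smul_neg]; ring] at this
  exact fun x => ⟨aux (hH x).2 (hH x).1.1 fun m hm => by simpa using hm,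
    aux (hH x).1 (hH x).2.1 fun m hm => by simpa using hm⟩

theorem MassConcave.isRayConcave {H : E N × ℝ → ℝ≥0∞} (hH : MassConcave H)
    (h0 : ∀ x, H (x, 0) = 0) : IsRayConcave H := by
  refine ⟨h0, fun x m a l ha hal => ?_⟩
  have pos : ∀ {G : E N × ℝ → ℝ≥0∞} (_ : MassConcave G) {m : ℝ}, 0 < m →
      (a : ℝ≥0∞) * G (x, m) ≤ G (x, l * m) := by
    intro G hG m hm
    exact mul_le_of_concaveOn_Ioi (hG x).1 hm ha (by gcongr)
  rcases lt_trichotomy m 0 with hm | rfl | hm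
  · simpa [HMass.reflect] using pos hH.reflect (neg_pos.2 hm)
  · simp [h0]
  · exact pos hH hm

namespace IsRayConcave

variable {K : E N × ℝ → ℝ≥0∞}

theorem reflect (hK : IsRayConcave K) : IsRayConcave (reflect K) :=
  ⟨fun x => by simp [HMass.reflect, hK.zero], fun x m a l ha hal => by
    simpa [HMass.reflect] using hK.scale x (-m) a l ha hal⟩

/-- The comparison `a K(x,m) ≤ K(x,m')` for positive masses. -/
theorem mul_le (hK : IsRayConcave K) (x : E N) {m m' : ℝ} (hm : 0 < m) (hm' : 0 ≤ m') {a : ℝ≥0}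
    (ha : a ≤ 1) (ham : a * m ≤ m') : (a : ℝ≥0∞) * K (x, m) ≤ K (x, m') := by
  have h := hK.scale x m a (.mk (m' / m) (by positivity)) ha
    (by rw [← NNReal.coe_le_coe]; exact (le_div_iff₀ hm).2 ham)
  rwa [NNReal.coe_mk, div_mul_cancel₀ _ hm.ne'] at h

theorem mono (hK : IsRayConcave K) (x : E N) {m m' : ℝ} (hm : 0 ≤ m) (h : m ≤ m') :
    K (x, m) ≤ K (x, m') := by
  rcases hm.eq_or_lt with rfl | hm
  · simp [hK.zero]
  · simpa using hK.mul_le x hm (hm.le.trans h) le_rfl (by simpa using h)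

theorem mul_ofReal_le (hK : IsRayConcave K) (x : E N) {m m' : ℝ} (hm : 0 < m) (h : m ≤ m') :
    K (x, m') * ENNReal.ofReal m ≤ K (x, m) * ENNReal.ofReal m' := by
  have hm' := hm.trans_le h
  have := hK.mul_le x hm' hm.le (a := .mk (m / m') (by positivity))
    (by rw [← NNReal.coe_le_coe]; exact (div_le_one hm').2 h)
    (by rw [NNReal.coe_mk, div_mul_cancel₀ _ hm'.ne'])
  calc K (x, m') * ENNReal.ofReal m
      = ENNReal.ofReal (m / m') * K (x, m') * ENNReal.ofReal m' := by
        rw [mul_right_comm, ← ENNReal.ofReal_mul (by positivity), div_mul_cancel₀ _ hm'.ne',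
          mul_comm]
    _ ≤ K (x, m) * ENNReal.ofReal m' := by
        gcongr
        rwa [ENNReal.ofReal, Real.toNNReal_of_nonneg (by positivity)]

theorem le_of_mul_ofReal_le (hK : IsRayConcave K) (x : E N) {m t : ℝ} (hm : 0 < m) (h : m ≤ t)
    {c : ℝ≥0∞} (hc : c * ENNReal.ofReal t ≤ K (x, t)) : c * ENNReal.ofReal m ≤ K (x, m) := by
  have ht := hm.trans_le h
  have h0 : ENNReal.ofReal t ≠ 0 := by simpa using ht
  rw [← ENNReal.mul_le_mul_iff_left h0 ENNReal.ofReal_ne_top]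
  calc c * ENNReal.ofReal m * ENNReal.ofReal t = c * ENNReal.ofReal t * ENNReal.ofReal m := by ring
    _ ≤ K (x, t) * ENNReal.ofReal m := by gcongr
    _ ≤ K (x, m) * ENNReal.ofReal t := hK.mul_ofReal_le x hm h

/-- The slope at m + m' is at most the slopes at m and at m'; weighting these two comparisons by m
and m' and adding gives subadditivity. -/
theorem add_le_of_nonneg (hK : IsRayConcave K) (x : E N) {m m' : ℝ} (hm : 0 ≤ m) (hm' : 0 ≤ m') :
    K (x, m + m') ≤ K (x, m) + K (x, m') := by
  rcases hm.eq_or_lt with rfl | hm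
  · simp
  rcases hm'.eq_or_lt with rfl | hm'
  · simp
  have h0 : ENNReal.ofReal (m + m') ≠ 0 := by simp; positivity
  rw [← ENNReal.mul_le_mul_iff_left h0 ENNReal.ofReal_ne_top]
  calc K (x, m + m') * ENNReal.ofReal (m + m')
      = K (x, m + m') * ENNReal.ofReal m + K (x, m + m') * ENNReal.ofReal m' := by
        rw [ENNReal.ofReal_add hm.le hm'.le, mul_add]
    _ ≤ K (x, m) * ENNReal.ofReal (m + m') + K (x, m') * ENNReal.ofReal (m + m') :=
        add_le_add (hK.mul_ofReal_le x hm (by linarith)) (hK.mul_ofReal_le x hm' (by linarith))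
    _ = _ := by rw [add_mul]

theorem add_le_of_opposite (hK : IsRayConcave K) (x : E N) {m m' : ℝ} (hm' : m' ≤ 0)
    (h : 0 ≤ m + m') : K (x, m + m') ≤ K (x, m) + K (x, m') :=
  (hK.mono x h (by linarith)).trans le_self_add

theorem add_le (hK : IsRayConcave K) (x : E N) (m m' : ℝ) :
    K (x, m + m') ≤ K (x, m) + K (x, m') := by
  have pos : ∀ {G : E N × ℝ → ℝ≥0∞} (_ : IsRayConcave G) (m m' : ℝ), 0 ≤ m + m' →
      G (x, m + m') ≤ G (x, m) + G (x, m') := by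
    intro G hG m m' h
    rcases le_total 0 m with hm | hm <;> rcases le_total 0 m' with hm' | hm'
    · exact hG.add_le_of_nonneg x hm hm'
    · exact hG.add_le_of_opposite x hm' h
    · rw [add_comm m, add_comm (G _)]
      exact hG.add_le_of_opposite x hm (by linarith)
    · exact hG.add_le_of_opposite x hm' h
  rcases le_total 0 (m + m') with h | h
  · exact pos hK m m' h
  · have := pos hK.reflect (-m) (-m') (by linarith)
    simp only [HMass.reflect, neg_neg, neg_add_rev] at this
    rwa [add_comm m' m] at this

/-! ### Slopes at the origin -/

theorem tendsto_slope (hK : IsRayConcave K) (x : E N) :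
    Tendsto (fun m => K (x, m) / ENNReal.ofReal |m|) (𝓝[>] (0 : ℝ))
      (𝓝 (sSup ((fun m => K (x, m) / ENNReal.ofReal |m|) '' Ioi 0))) := by
  refine AntitoneOn.tendsto_nhdsGT (fun m hm m' hm' h => ?_) (OrderTop.bddAbove _)
  have hm0 : (0 : ℝ) < m := hm
  have hm0' : (0 : ℝ) < m' := hm'
  simp only [abs_of_pos hm0, abs_of_pos hm0']
  rw [ENNReal.div_le_iff (by simpa using hm0') ENNReal.ofReal_ne_top, ← ENNReal.mul_div_right_comm,
    ENNReal.le_div_iff_mul_le (by simp [hm0]) (by simp)]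
  exact hK.mul_ofReal_le x hm0 h

theorem rightSlope_eq (hK : IsRayConcave K) (x : E N) :
    rightSlope K x = sSup ((fun m => K (x, m) / ENNReal.ofReal |m|) '' Ioi 0) :=
  (hK.tendsto_slope x).limUnder_eq

theorem tendsto_rightSlope (hK : IsRayConcave K) (x : E N) :
    Tendsto (fun m => K (x, m) / ENNReal.ofReal |m|) (𝓝[>] (0 : ℝ)) (𝓝 (rightSlope K x)) := by
  rw [hK.rightSlope_eq]
  exact hK.tendsto_slope x

end IsRayConcave

theorem tendsto_left_iff {K : E N × ℝ → ℝ≥0∞} (x : E N) {l : Filter ℝ≥0∞} :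
    Tendsto (fun m => K (x, m) / ENNReal.ofReal |m|) (𝓝[<] (0 : ℝ)) l ↔
      Tendsto (fun m => reflect K (x, m) / ENNReal.ofReal |m|) (𝓝[>] (0 : ℝ)) l := by
  have h : 𝓝[<] (0 : ℝ) = map Neg.neg (𝓝[>] (0 : ℝ)) := by
    simp
  rw [h, tendsto_map'_iff]
  simp [Function.comp_def, reflect]

namespace IsRayConcave

variable {K : E N × ℝ → ℝ≥0∞}

theorem leftSlope_eq (hK : IsRayConcave K) (x : E N) :
    leftSlope K x = rightSlope (HMass.reflect K) x :=
  ((tendsto_left_iff x).2 (hK.reflect.tendsto_rightSlope x)).limUnder_eq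

theorem tendsto_leftSlope (hK : IsRayConcave K) (x : E N) :
    Tendsto (fun m => K (x, m) / ENNReal.ofReal |m|) (𝓝[<] (0 : ℝ)) (𝓝 (leftSlope K x)) := by
  rw [hK.leftSlope_eq]
  exact (tendsto_left_iff x).2 (hK.reflect.tendsto_rightSlope x)

theorem le_rightSlope_mul (hK : IsRayConcave K) (x : E N) {m : ℝ} (hm : 0 ≤ m) :
    K (x, m) ≤ rightSlope K x * ENNReal.ofReal m := by
  rcases hm.eq_or_lt with rfl | hm
  · simp [hK.zero]
  · rw [← ENNReal.div_le_iff (by simpa using hm) ENNReal.ofReal_ne_top, hK.rightSlope_eq]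
    exact le_sSup ⟨m, hm, by simp [abs_of_pos hm]⟩

theorem exists_mul_lt_of_lt_rightSlope (hK : IsRayConcave K) {x : E N} {c : ℝ≥0∞}
    (hc : c < rightSlope K x) : ∃ m : ℝ, 0 < m ∧ c * ENNReal.ofReal m < K (x, m) := by
  rw [hK.rightSlope_eq, lt_sSup_iff] at hc
  obtain ⟨_, ⟨m, hm, rfl⟩, h⟩ := hc
  have hm : (0 : ℝ) < m := hm
  refine ⟨m, hm, ?_⟩
  simp only [abs_of_pos hm] at h
  rwa [ENNReal.lt_div_iff_mul_lt (by simp [hm]) (by simp)] at h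

/-- By monotonicity of the slopes the limit at 0⁺ is a supremum over m > 0 of functions lower
semicontinuous in x. -/
theorem lowerSemicontinuous_rightSlope (hK : IsRayConcave K) (hlsc : LowerSemicontinuous K) :
    LowerSemicontinuous (rightSlope K) := by
  intro x c hc
  obtain ⟨m, hm, h⟩ := hK.exists_mul_lt_of_lt_rightSlope hc
  have hm0 : ENNReal.ofReal m ≠ 0 := by simpa using hm
  have hcont : Continuous fun y : E N => (y, m) := by fun_prop
  filter_upwards [(hlsc.comp hcont) x _ h] with y hy
  have := hy.trans_le (hK.le_rightSlope_mul y hm.le)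
  exact (ENNReal.mul_lt_mul_iff_left hm0 ENNReal.ofReal_ne_top).1 this

end IsRayConcave

/-! ### The lower semicontinuous envelope -/

theorem lscEnvelope_le (H : E N × ℝ → ℝ≥0∞) : lscEnvelope H ≤ H :=
  sSup_le fun _ hG => hG.1

theorem le_lscEnvelope {H G : E N × ℝ → ℝ≥0∞} (h : G ≤ H) (hG : LowerSemicontinuous G) :
    G ≤ lscEnvelope H :=
  le_sSup ⟨h, hG⟩

theorem lowerSemicontinuous_lscEnvelope (H : E N × ℝ → ℝ≥0∞) :
    LowerSemicontinuous (lscEnvelope H) := by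
  have : lscEnvelope H
      = fun p => ⨆ G : {G : E N × ℝ → ℝ≥0∞ | G ≤ H ∧ LowerSemicontinuous G}, (G : _ → ℝ≥0∞) p := by
    ext p
    rw [lscEnvelope, sSup_apply]
  rw [this]
  exact lowerSemicontinuous_iSup fun G => G.2.2

/-- If H ≥ c on an open neighbourhood U of p, then c·1_U is a lower semicontinuous minorant with
value c at p. -/
theorem frequently_lt_of_lscEnvelope_lt {H : E N × ℝ → ℝ≥0∞} {p : E N × ℝ} {c : ℝ≥0∞}
    (hc : lscEnvelope H p < c) : ∃ᶠ q in 𝓝 p, H q < c := by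
  intro h
  obtain ⟨U, hU, hUo, hpU⟩ := eventually_nhds_iff.1 h
  have hG : U.indicator (fun _ => c) ≤ H := by
    intro q
    by_cases hq : q ∈ U
    · simpa [hq] using hU q hq
    · simp [hq]
  have := le_lscEnvelope hG (hUo.lowerSemicontinuous_indicator zero_le) p
  simp only [hpU, indicator_of_mem] at this
  exact this.not_gt hc

theorem IsRayConcave.lscEnvelope {H : E N × ℝ → ℝ≥0∞} (hH : IsRayConcave H) :
    IsRayConcave (lscEnvelope H) := by
  refine ⟨fun x => le_antisymm ((lscEnvelope_le H _).trans (hH.zero x).le) zero_le, ?_⟩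
  intro x m a l ha hal
  rcases eq_or_ne a 0 with rfl | ha0
  · simp
  have hl : (l : ℝ) ≠ 0 := by exact_mod_cast ((pos_iff_ne_zero.2 ha0).trans_le hal).ne'
  have hcont : Continuous fun p : E N × ℝ => (p.1, p.2 / l) := by fun_prop
  -- Rescaling the mass by 1/l and multiplying by a turns the envelope into another lower
  -- semicontinuous function, which lies below `H` by the ray inequality for `H`; the envelope
  -- therefore dominates it.
  have hlsc : LowerSemicontinuous
      fun p : E N × ℝ => (a : ℝ≥0∞) * HMass.lscEnvelope H (p.1, p.2 / l) :=
    (ENNReal.continuous_const_mul ENNReal.coe_ne_top).comp_lowerSemicontinuous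
      ((lowerSemicontinuous_lscEnvelope H).comp hcont) fun _ _ h => mul_le_mul_right h _
  have := le_lscEnvelope (H := H) (fun p => ?_) hlsc (x, l * m)
  · simpa [mul_div_cancel_left₀ _ hl] using this
  · calc (a : ℝ≥0∞) * HMass.lscEnvelope H (p.1, p.2 / l) ≤ a * H (p.1, p.2 / l) := by
          gcongr; exact lscEnvelope_le H _
      _ ≤ H (p.1, l * (p.2 / l)) := hH.scale _ _ _ _ ha hal
      _ = H p := by rw [mul_div_cancel₀ _ hl]

theorem IsRayConcave.isAdmissible {K : E N × ℝ → ℝ≥0∞} (hK : IsRayConcave K)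
    (hlsc : LowerSemicontinuous K) : IsAdmissible K :=
  ⟨hlsc.measurable, hK.tendsto_rightSlope, hK.tendsto_leftSlope⟩

theorem lowerSemicontinuous_reflect {K : E N × ℝ → ℝ≥0∞} (hlsc : LowerSemicontinuous K) :
    LowerSemicontinuous (reflect K) :=
  hlsc.comp (by fun_prop : Continuous fun p : E N × ℝ => (p.1, -p.2))

/-! ### The atomic functional -/

theorem dirac_add (x : E N) (a b : ℝ) :
    (VectorMeasure.dirac x (a + b) : SignedMeasure (E N))
      = VectorMeasure.dirac x a + VectorMeasure.dirac x b := by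
  ext s hs
  by_cases hx : x ∈ s <;> simp [hx, hs]

theorem dirac_neg (x : E N) (a : ℝ) :
    (VectorMeasure.dirac x (-a) : SignedMeasure (E N)) = -VectorMeasure.dirac x a := by
  ext s hs
  by_cases hx : x ∈ s <;> simp [hx, hs]

theorem massAtom_le_sum (K : E N × ℝ → ℝ≥0∞) (s : Finset (E N)) (m : E N → ℝ) :
    massAtom K (∑ x ∈ s, VectorMeasure.dirac x (m x)) ≤ ∑ x ∈ s, K (x, m x) :=
  iInf_le_of_le s <| iInf_le_of_le m <| iInf_le_of_le rfl le_rfl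

theorem massAtom_zero (K : E N × ℝ → ℝ≥0∞) : massAtom K 0 = 0 := by
  simpa using massAtom_le_sum K ∅ 0

theorem massAtom_dirac_le (K : E N × ℝ → ℝ≥0∞) (x : E N) (m : ℝ) :
    massAtom K (VectorMeasure.dirac x m) ≤ K (x, m) := by
  simpa using massAtom_le_sum K {x} fun _ => m

theorem massAtom_neg_le (K : E N × ℝ → ℝ≥0∞) (u : SignedMeasure (E N)) :
    massAtom K (-u) ≤ massAtom (reflect K) u := by
  refine le_iInf fun s => le_iInf fun m => le_iInf fun h => ?_
  have : -u = ∑ x ∈ s, VectorMeasure.dirac x (-m x) := by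
    simp only [h, dirac_neg, Finset.sum_neg_distrib]
  rw [this]
  exact massAtom_le_sum K s fun x => -m x

theorem IsRayConcave.massAtom_add_le {K : E N × ℝ → ℝ≥0∞} (hK : IsRayConcave K)
    (u v : SignedMeasure (E N)) : massAtom K (u + v) ≤ massAtom K u + massAtom K v := by
  classical
  unfold massAtom
  simp only [ENNReal.iInf_add, ENNReal.add_iInf]
  refine le_iInf fun t => le_iInf fun n => le_iInf fun hv =>
    le_iInf fun s => le_iInf fun m => le_iInf fun hu => ?_
  have extend : ∀ (r : Finset (E N)) (k : E N → ℝ), r ⊆ s ∪ t →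
      ∑ x ∈ r, (VectorMeasure.dirac x (k x) : SignedMeasure (E N))
        = ∑ x ∈ s ∪ t, VectorMeasure.dirac x (if x ∈ r then k x else 0) := by
    intro r k hr
    rw [← Finset.sum_subset hr]
    · exact Finset.sum_congr rfl fun x hx => by simp [hx]
    · intro x _ hx
      simp [hx]
  have extendK : ∀ (r : Finset (E N)) (k : E N → ℝ), r ⊆ s ∪ t →
      ∑ x ∈ s ∪ t, K (x, if x ∈ r then k x else 0) = ∑ x ∈ r, K (x, k x) := by
    intro r k hr
    rw [← Finset.sum_subset hr]
    · exact Finset.sum_congr rfl fun x hx => by simp [hx]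
    · intro x _ hx
      simp [hx, hK.zero]
  refine iInf_le_of_le (s ∪ t) <| iInf_le_of_le
    (fun x => (if x ∈ s then m x else 0) + if x ∈ t then n x else 0) <| iInf_le_of_le ?_ ?_
  · rw [hu, hv, extend s m Finset.subset_union_left, extend t n Finset.subset_union_right,
      ← Finset.sum_add_distrib]
    exact Finset.sum_congr rfl fun x _ => (dirac_add _ _ _).symm
  · rw [← extendK s m Finset.subset_union_left, ← extendK t n Finset.subset_union_right,
      ← Finset.sum_add_distrib]
    exact Finset.sum_le_sum fun x _ => hK.add_le x _ _

/-- The points may coincide, as they can after atoms have been perturbed; subadditivity absorbs the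
merging. -/
theorem IsRayConcave.massAtom_sum_dirac_le {K : E N × ℝ → ℝ≥0∞} (hK : IsRayConcave K)
    {ι : Type*} (s : Finset ι) (x : ι → E N) (m : ι → ℝ) :
    massAtom K (∑ i ∈ s, VectorMeasure.dirac (x i) (m i)) ≤ ∑ i ∈ s, K (x i, m i) := by
  classical
  induction s using Finset.induction_on with
  | empty => simp [massAtom_zero]
  | insert i s hi ih =>
    rw [Finset.sum_insert hi, Finset.sum_insert hi]
    exact (hK.massAtom_add_le _ _).trans (add_le_add (massAtom_dirac_le _ _ _) ih)

/-! ### Jordan decompositions -/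

/-- The positive part of the Jordan decomposition. -/
abbrev pos (u : SignedMeasure (E N)) : Measure (E N) := u.toJordanDecomposition.posPart

/-- The negative part of the Jordan decomposition. -/
abbrev neg (u : SignedMeasure (E N)) : Measure (E N) := u.toJordanDecomposition.negPart

theorem pos_sub_neg (u : SignedMeasure (E N)) :
    (pos u).toSignedMeasure - (neg u).toSignedMeasure = u :=
  u.toSignedMeasure_toJordanDecomposition

theorem neg_eq_pos_neg (u : SignedMeasure (E N)) : neg u = pos (-u) := by
  simp [pos, neg, SignedMeasure.toJordanDecomposition_neg]

theorem exists_measurableSet_hahn (u : SignedMeasure (E N)) :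
    ∃ P, MeasurableSet P ∧ neg u P = 0 ∧ pos u Pᶜ = 0 := by
  obtain ⟨P, hP, h1, h2⟩ := u.toJordanDecomposition.mutuallySingular
  exact ⟨Pᶜ, hP.compl, h2, by simpa using h1⟩

theorem toJordanDecomposition_restrict (u : SignedMeasure (E N)) {s : Set (E N)}
    (hs : MeasurableSet s) :
    pos (u.restrict s) = (pos u).restrict s ∧ neg (u.restrict s) = (neg u).restrict s := by
  let j : JordanDecomposition (E N) :=
    { posPart := (pos u).restrict s
      negPart := (neg u).restrict s
      posPart_finite := inferInstance
      negPart_finite := inferInstance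
      mutuallySingular := (u.toJordanDecomposition.mutuallySingular.restrict s).symm.restrict s
        |>.symm }
  have hj : u.restrict s = j.toSignedMeasure := by
    conv_lhs => rw [← pos_sub_neg u]
    rw [VectorMeasure.restrict_sub, JordanDecomposition.toSignedMeasure,
      ← Measure.toSignedMeasure_restrict_eq_restrict_toSignedMeasure _ _ hs,
      ← Measure.toSignedMeasure_restrict_eq_restrict_toSignedMeasure _ _ hs]
  have := SignedMeasure.toJordanDecomposition_eq hj
  exact ⟨by rw [pos, this], by rw [neg, this]⟩

theorem apply_singleton (u : SignedMeasure (E N)) (x : E N) :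
    u {x} = (pos u).real {x} - (neg u).real {x} :=
  u.apply_eq_posPart_real_sub_negPart_real (measurableSet_singleton x)

theorem pos_singleton_eq_zero_or (u : SignedMeasure (E N)) (x : E N) :
    (pos u).real {x} = 0 ∨ (neg u).real {x} = 0 := by
  obtain ⟨P, -, h1, h2⟩ := exists_measurableSet_hahn u
  by_cases hx : x ∈ P
  · exact Or.inr (by simp [measureReal_def, measure_mono_null (singleton_subset_iff.2 hx) h1])
  · exact Or.inl (by
      simp [measureReal_def, measure_mono_null (singleton_subset_iff.2 (mem_compl hx)) h2])

theorem integrable_boundedContinuous (u : SignedMeasure (E N)) (f : E N →ᵇ ℝ) :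
    u.Integrable f := by
  have : IsFiniteMeasure u.variation := by
    rw [← SignedMeasure.totalVariation_eq_variation, SignedMeasure.totalVariation]
    infer_instance
  exact f.integrable _

theorem integral_eq_pos_sub_neg (u : SignedMeasure (E N)) (f : E N →ᵇ ℝ) :
    ∫ᵛ x, f x ∂<•u = ∫ x, f x ∂(pos u) - ∫ x, f x ∂(neg u) := by
  conv_lhs => rw [← pos_sub_neg u]
  rw [VectorMeasure.integral_sub_vectorMeasure (integrable_boundedContinuous _ f)
    (integrable_boundedContinuous _ f), VectorMeasure.integral_toSignedMeasure,
    VectorMeasure.integral_toSignedMeasure]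

/-! ### The mass of the positive part -/

theorem countable_measure_singleton_ne_zero (μ : Measure (E N)) [IsFiniteMeasure μ] :
    {x | μ {x} ≠ 0}.Countable := by
  have h := Measure.countable_meas_pos_of_disjoint_iUnion (μ := μ)
    (As := fun x : E N => ({x} : Set (E N))) (fun x => measurableSet_singleton x)
    (fun x y hxy => by simpa [Function.onFun] using hxy)
  exact h.mono fun x hx => pos_iff_ne_zero.2 hx

theorem measurableSet_singleton_null (μ : Measure (E N)) [IsFiniteMeasure μ] :
    MeasurableSet {x | μ {x} = 0} := by
  have := (countable_measure_singleton_ne_zero μ).measurableSet.compl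
  simpa [compl_ofPred] using this

/-- A finite measure has countably many atoms, so the integral over them is a sum, and extending the
sum to all points adds only zeros. -/
theorem setLIntegral_eq_atoms_add (μ : Measure (E N)) [IsFiniteMeasure μ] (f : E N → ℝ≥0∞)
    {A : Set (E N)} (hA : MeasurableSet A) :
    ∫⁻ x in A, f x ∂μ = ∫⁻ x in A, f x * μ {x} ∂Measure.count
      + ∫⁻ x in A, f x ∂(μ.restrict {x | μ {x} = 0}) := by
  have hD := measurableSet_singleton_null μ
  have hc : (A ∩ {x | μ {x} = 0}ᶜ).Countable :=
    (countable_measure_singleton_ne_zero μ).mono fun x hx => hx.2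
  rw [← lintegral_inter_add_sdiff f A hD, add_comm, Measure.restrict_restrict hA]
  congr 1
  rw [sdiff_eq, lintegral_countable f hc, ← lintegral_indicator hA, lintegral_count,
    tsum_subtype (A ∩ {x | μ {x} = 0}ᶜ) fun x => f x * μ {x}]
  refine tsum_congr fun x => ?_
  by_cases hx : x ∈ A <;> by_cases h0 : μ {x} = 0 <;> simp [hx, h0]

/-- The `K`-mass of a positive measure, as a measure. -/
def posMass (K : E N × ℝ → ℝ≥0∞) (μ : Measure (E N)) : Measure (E N) :=
  Measure.count.withDensity (fun x => K (x, μ.real {x}))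
    + (μ.restrict {x | μ {x} = 0}).withDensity (rightSlope K)

theorem posMass_apply (K : E N × ℝ → ℝ≥0∞) (μ : Measure (E N)) {A : Set (E N)}
    (hA : MeasurableSet A) :
    posMass K μ A = ∫⁻ x in A, K (x, μ.real {x}) ∂Measure.count
      + ∫⁻ x in A, rightSlope K x ∂(μ.restrict {x | μ {x} = 0}) := by
  rw [posMass, Measure.add_apply, withDensity_apply _ hA, withDensity_apply _ hA]

theorem restrict_atoms_compl_pos (u : SignedMeasure (E N)) :
    pos (diffusePart u) = (pos u).restrict {x | pos u {x} = 0} := by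
  rw [diffusePart, (toJordanDecomposition_restrict u (measurableSet_atoms u).compl).1]
  refine Measure.restrict_congr_set (ae_eq_set.2 ⟨?_, ?_⟩)
  · convert! measure_empty (μ := pos u)
    refine sdiff_eq_empty.2 fun x hx => ?_
    have h1 : u {x} = 0 := by simpa [atoms] using hx
    rw [apply_singleton] at h1
    have h2 : (pos u).real {x} = 0 := by
      rcases pos_singleton_eq_zero_or u x with h | h <;> linarith
    simpa [measureReal_def, ENNReal.toReal_eq_zero_iff] using h2
  -- What remains are atoms of u that do not charge the positive part: countably many points of
  -- positive-part mass zero.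
  · refine (measure_null_iff_singleton ((countable_atoms u).mono fun x hx => ?_)).2 fun x hx => hx.1
    simpa using hx.2

theorem massH_eq_posMass {K : E N × ℝ → ℝ≥0∞} (hK : IsRayConcave K) (u : SignedMeasure (E N)) :
    massH K u = posMass K (pos u) univ + posMass (reflect K) (pos (-u)) univ := by
  have hneg : neg (diffusePart u) = pos (diffusePart (-u)) := by
    have : diffusePart (-u) = -diffusePart u := by
      have : atoms (-u) = atoms u := by ext x; simp [atoms]
      rw [diffusePart, this, VectorMeasure.restrict_neg, diffusePart]
    rw [this, neg_eq_pos_neg]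
  have hatom : ∫⁻ x, K (x, u {x}) ∂Measure.count
      = ∫⁻ x, K (x, (pos u).real {x}) ∂Measure.count
        + ∫⁻ x, reflect K (x, (pos (-u)).real {x}) ∂Measure.count := by
    simp only [lintegral_count, ← ENNReal.tsum_add, reflect, ← neg_eq_pos_neg, apply_singleton]
    refine tsum_congr fun x => ?_
    rcases pos_singleton_eq_zero_or u x with h | h <;> simp [h, hK.zero]
  simp only [posMass_apply _ _ MeasurableSet.univ, Measure.restrict_univ, massH]
  rw [hatom, show (diffusePart u).toJordanDecomposition.negPart = _ from hneg,
    show (diffusePart u).toJordanDecomposition.posPart = _ from restrict_atoms_compl_pos u,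
    restrict_atoms_compl_pos]
  simp only [hK.leftSlope_eq]
  abel

/-- Either some atom in A has mass at least t and alone costs at least ct by monotonicity, or all
atoms are smaller than t, and then every slope involved, including the one at 0⁺, is at least c. -/
theorem IsRayConcave.mul_min_le_posMass {K : E N × ℝ → ℝ≥0∞} (hK : IsRayConcave K)
    (μ : Measure (E N)) [IsFiniteMeasure μ] {A : Set (E N)} (hA : MeasurableSet A) {t : ℝ}
    (ht : 0 < t) {c : ℝ≥0∞} (hc : ∀ y ∈ A, c * ENNReal.ofReal t ≤ K (y, t)) :
    c * min (μ A) (ENNReal.ofReal t) ≤ posMass K μ A := by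
  rw [posMass_apply K μ hA]
  by_cases h : ∃ y ∈ A, t ≤ μ.real {y}
  · obtain ⟨y, hyA, hy⟩ := h
    calc c * min (μ A) (ENNReal.ofReal t) ≤ c * ENNReal.ofReal t := by gcongr; exact min_le_right _ _
      _ ≤ K (y, μ.real {y}) := (hc y hyA).trans (hK.mono y ht.le hy)
      _ ≤ ∫⁻ x in A, K (x, μ.real {x}) ∂Measure.count := by
          rw [← lintegral_indicator hA, lintegral_count]
          refine le_trans (le_of_eq ?_) (ENNReal.le_tsum y)
          simp [hyA]
      _ ≤ _ := le_self_add
  · push Not at h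
    calc c * min (μ A) (ENNReal.ofReal t) ≤ c * μ A := by gcongr; exact min_le_left _ _
      _ = ∫⁻ x in A, c ∂μ := by simp
      _ = _ := setLIntegral_eq_atoms_add μ _ hA
      _ ≤ _ := by
        refine add_le_add (setLIntegral_mono' hA fun x hx => ?_)
          (setLIntegral_mono' hA fun x hx => ?_)
        · rcases eq_or_ne (μ {x}) 0 with h0 | h0
          · simp [h0]
          · have hpos : 0 < μ.real {x} := ENNReal.toReal_pos h0 (measure_ne_top _ _)
            have := hK.le_of_mul_ofReal_le x hpos (h x hx).le (hc x hx)
            rwa [ofReal_measureReal] at this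
        · have ht0 : ENNReal.ofReal t ≠ 0 := by simpa using ht
          exact (ENNReal.mul_le_mul_iff_left ht0 ENNReal.ofReal_ne_top).1
            ((hc x hx).trans (hK.le_rightSlope_mul x ht.le))

/-! ### Suprema of countably many step functions -/

theorem measurable_finset_sup {α ι : Type*} [MeasurableSpace α] (s : Finset ι)
    {f : ι → α → ℝ≥0∞} (hf : ∀ i, Measurable (f i)) : Measurable fun x => s.sup fun i => f i x := by
  simp only [Finset.sup_eq_iSup]
  exact Measurable.biSup _ s.countable_toSet fun i _ => hf i

theorem exists_disjoint_sup_indicator_le {α ι : Type*} [MeasurableSpace α] (c : ι → ℝ≥0)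
    {A : ι → Set α} (hA : ∀ i, MeasurableSet (A i)) (s : Finset ι) :
    ∃ B : ι → Set α, (∀ i, MeasurableSet (B i)) ∧ (∀ i, B i ⊆ A i) ∧
      (s : Set ι).PairwiseDisjoint B ∧
      ∀ x, s.sup (fun i => (A i).indicator (fun _ => (c i : ℝ≥0∞)) x)
        ≤ ∑ i ∈ s, (B i).indicator (fun _ => (c i : ℝ≥0∞)) x := by
  classical
  induction s using Finset.induction_on with
  | empty => exact ⟨A, hA, fun i => Subset.rfl, by simp, by simp⟩
  | insert j s hj ih =>
    obtain ⟨B, hBm, hBA, hBd, hB⟩ := ih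
    set g : α → ℝ≥0∞ := fun x => s.sup fun i => (A i).indicator (fun _ => (c i : ℝ≥0∞)) x with hg
    have hgm : Measurable g :=
      measurable_finset_sup s fun i => measurable_const.indicator (hA i)
    -- The new index takes only the points where its value strictly beats the earlier supremum, and
    -- these are removed from the old pieces.
    set D : Set α := A j ∩ {x | g x < c j} with hD
    have hDm : MeasurableSet D := (hA j).inter (measurableSet_lt hgm measurable_const)
    refine ⟨fun i => if i = j then D else B i \ D, fun i => ?_, fun i => ?_, ?_, fun x => ?_⟩
    · dsimp only
      split_ifs
      exacts [hDm, (hBm i).diff hDm]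
    · dsimp only
      split_ifs with h
      · exact h ▸ inter_subset_left
      · exact sdiff_subset.trans (hBA i)
    · rw [Finset.coe_insert, pairwiseDisjoint_insert_of_notMem (by simpa using hj)]
      refine ⟨fun i hi k hk hik => ?_, fun i hi => ?_⟩
      · have hij : i ≠ j := fun h => hj (h ▸ hi)
        have hkj : k ≠ j := fun h => hj (h ▸ hk)
        simp only [Function.onFun, hij, hkj, if_false]
        exact (hBd hi hk hik).mono sdiff_subset sdiff_subset
      · have hij : i ≠ j := fun h => hj (h ▸ hi)
        simp only [hij, if_false, if_true]
        exact disjoint_sdiff_right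
    · rw [Finset.sum_insert hj, Finset.sup_insert]
      have hsum : ∑ i ∈ s, (if i = j then D else B i \ D).indicator (fun _ => (c i : ℝ≥0∞)) x
          = ∑ i ∈ s, (B i \ D).indicator (fun _ => (c i : ℝ≥0∞)) x :=
        Finset.sum_congr rfl fun i hi => by
          rw [if_neg (ne_of_mem_of_not_mem hi hj)]
      simp only [if_true]
      rw [hsum]
      by_cases hx : x ∈ D
      · refine le_trans (sup_le ?_ (hx.2.le)) (le_trans ?_ le_self_add)
        · exact indicator_le_self _ _ _
        · simp [hx]
      · have : ∑ i ∈ s, (B i \ D).indicator (fun _ => (c i : ℝ≥0∞)) x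
            = ∑ i ∈ s, (B i).indicator (fun _ => (c i : ℝ≥0∞)) x :=
          Finset.sum_congr rfl fun i _ => by simp [indicator, hx]
        rw [this]
        refine le_trans (sup_le ?_ (hB x)) le_add_self
        by_cases hxA : x ∈ A j
        · rw [indicator_of_mem hxA]
          refine le_trans ?_ (hB x)
          by_contra! h
          exact hx ⟨hxA, h⟩
        · simp [hxA]

theorem exists_disjoint_lt_sum_of_lt_lintegral_iSup {α ι : Type*} [MeasurableSpace α] [Countable ι]
    {μ : Measure α} (c : ι → ℝ≥0) {A : ι → Set α} (hA : ∀ i, MeasurableSet (A i)) {M : ℝ≥0∞}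
    (hM : M < ∫⁻ x, ⨆ i, (A i).indicator (fun _ => (c i : ℝ≥0∞)) x ∂μ) :
    ∃ (s : Finset ι) (B : ι → Set α), (∀ i, MeasurableSet (B i)) ∧ (∀ i, B i ⊆ A i) ∧
      (s : Set ι).PairwiseDisjoint B ∧ M < ∑ i ∈ s, c i * μ (B i) := by
  have hmeas : ∀ i, Measurable fun x => (A i).indicator (fun _ => (c i : ℝ≥0∞)) x :=
    fun i => measurable_const.indicator (hA i)
  have hsup : ∀ x, ⨆ i, (A i).indicator (fun _ => (c i : ℝ≥0∞)) x
      = ⨆ s : Finset ι, s.sup fun i => (A i).indicator (fun _ => (c i : ℝ≥0∞)) x := fun x => by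
    rw [iSup_eq_iSup_finset]
    exact iSup_congr fun s => (Finset.sup_eq_iSup _ _).symm
  simp only [hsup] at hM
  rw [lintegral_iSup_directed (fun s => (measurable_finset_sup s hmeas).aemeasurable)
    (directed_of_isDirected_le fun s t h x => Finset.sup_mono h), lt_iSup_iff] at hM
  obtain ⟨s, hs⟩ := hM
  obtain ⟨B, hBm, hBA, hBd, hB⟩ := exists_disjoint_sup_indicator_le c hA s
  refine ⟨s, B, hBm, hBA, hBd, hs.trans_le ((lintegral_mono hB).trans ?_)⟩
  rw [lintegral_finsetSum s fun i _ => measurable_const.indicator (hBm i)]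
  exact Finset.sum_le_sum fun i _ => by rw [lintegral_indicator_const (hBm i)]

/-! ### Lower semicontinuity of the mass -/

theorem liminf_add_liminf_le {α : Type*} (l : Filter α) (f g : α → ℝ≥0∞) :
    liminf f l + liminf g l ≤ liminf (fun x => f x + g x) l := by
  rcases eq_or_ne (liminf f l) 0 with hf | hf
  · rw [hf, zero_add]
    exact liminf_le_liminf (Eventually.of_forall fun x => le_add_self)
  rcases eq_or_ne (liminf g l) 0 with hg | hg
  · rw [hg, add_zero]
    exact liminf_le_liminf (Eventually.of_forall fun x => le_self_add)
  refine le_of_forall_lt_imp_le_of_dense fun d hd => ?_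
  obtain ⟨a, ha, b, hb, hab⟩ := ENNReal.exists_lt_add_of_lt_add hd hf hg
  refine hab.le.trans (le_liminf_of_le (by isBoundedDefault) ?_)
  filter_upwards [eventually_lt_of_lt_liminf ha, eventually_lt_of_lt_liminf hb] with x hx hx'
  exact add_le_add hx.le hx'.le


theorem ofReal_integral_le_pos (v : SignedMeasure (E N)) (f : E N →ᵇ ℝ) {U : Set (E N)}
    (hU : MeasurableSet U) (hf : ∀ x, f x ∈ Icc (0 : ℝ) 1) (hfU : EqOn f 0 Uᶜ) :
    ENNReal.ofReal (∫ᵛ x, f x ∂<•v) ≤ pos v U := by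
  refine ENNReal.ofReal_le_of_le_toReal ?_
  rw [integral_eq_pos_sub_neg]
  have h1 : 0 ≤ ∫ x, f x ∂(neg v) := integral_nonneg fun x => (hf x).1
  have h2 : ∫ x, f x ∂(pos v) ≤ ∫ x, U.indicator 1 x ∂(pos v) := by
    refine integral_mono (f.integrable _) ((integrable_const 1).indicator hU) fun x => ?_
    by_cases hx : x ∈ U
    · simpa [hx] using (hf x).2
    · simpa [hx] using (hfU hx).le
  rw [integral_indicator_one hU] at h2
  exact (sub_le_self _ h1).trans h2

theorem pos_le_ofReal_integral_add (u : SignedMeasure (E N)) (f : E N →ᵇ ℝ) {C U : Set (E N)}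
    (hC : MeasurableSet C) (hU : MeasurableSet U) (hf : ∀ x, f x ∈ Icc (0 : ℝ) 1)
    (hfU : EqOn f 0 Uᶜ) (hfC : EqOn f 1 C) :
    pos u C ≤ ENNReal.ofReal (∫ᵛ x, f x ∂<•u) + neg u U := by
  have h1 : ∫ x, C.indicator 1 x ∂(pos u) ≤ ∫ x, f x ∂(pos u) := by
    refine integral_mono ((integrable_const 1).indicator hC) (f.integrable _) fun x => ?_
    by_cases hx : x ∈ C
    · simpa [hx] using (hfC hx).ge
    · simpa [hx] using (hf x).1
  have h2 : ∫ x, f x ∂(neg u) ≤ ∫ x, U.indicator 1 x ∂(neg u) := by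
    refine integral_mono (f.integrable _) ((integrable_const 1).indicator hU) fun x => ?_
    by_cases hx : x ∈ U
    · simpa [hx] using (hf x).2
    · simpa [hx] using (hfU hx).le
  rw [integral_indicator_one hC] at h1
  rw [integral_indicator_one hU] at h2
  calc pos u C = ENNReal.ofReal ((pos u).real C) := by rw [ofReal_measureReal]
    _ ≤ ENNReal.ofReal (∫ᵛ x, f x ∂<•u + (neg u).real U) := by
        refine ENNReal.ofReal_le_ofReal ?_
        rw [integral_eq_pos_sub_neg]
        linarith
    _ ≤ _ := ENNReal.ofReal_add_le.trans (by rw [ofReal_measureReal])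

/-- Pairwise disjoint Borel sets can be replaced, up to a small mass, by test functions with
disjoint supports. -/
theorem exists_separating_functions (u : SignedMeasure (E N)) {ι : Type*} (s : Finset ι)
    {A B : ι → Set (E N)} (hA : ∀ i, IsOpen (A i)) (hB : ∀ i, MeasurableSet (B i))
    (hBA : ∀ i, B i ⊆ A i) (hd : (s : Set ι).PairwiseDisjoint B) {δ : ℝ≥0∞} (hδ : δ ≠ 0) :
    ∃ (U : ι → Set (E N)) (f : ι → E N →ᵇ ℝ), (∀ i, IsOpen (U i)) ∧ (∀ i, U i ⊆ A i) ∧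
      (s : Set ι).PairwiseDisjoint U ∧ (∀ i x, f i x ∈ Icc (0 : ℝ) 1) ∧
      (∀ i, EqOn (f i) 0 (U i)ᶜ) ∧
      ∀ i, pos u (B i) ≤ ENNReal.ofReal (∫ᵛ x, f i x ∂<•u) + (δ + δ) := by
  obtain ⟨P, hP, hPneg, hPpos⟩ := exists_measurableSet_hahn u
  -- Compact sets inside the positive Hahn set carry no negative mass, so they have open
  -- neighbourhoods of small negative mass. One δ pays for this inner approximation, the other for
  -- the negative mass in the neighbourhood.
  choose C hCB hC hCδ using fun i =>
    ((hB i).inter hP).exists_isCompact_lt_add (μ := pos u) (measure_ne_top _ _) hδ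
  choose O hCO hO hOδ using fun i => (C i).exists_isOpen_lt_of_lt (μ := neg u) δ (by
    rw [measure_mono_null ((hCB i).trans inter_subset_right) hPneg]
    exact pos_iff_ne_zero.2 hδ)
  -- Disjoint compact sets have disjoint neighbourhood filters, and for a finite family disjoint
  -- neighbourhoods can be chosen simultaneously.
  have hCd : (s : Set ι).PairwiseDisjoint fun i => 𝓝ˢ (C i) := fun i hi j hj hij =>
    separatedNhds_iff_disjoint.1 <| SeparatedNhds.of_isCompact_isCompact (hC i) (hC j) <|
      (hd hi hj hij).mono ((hCB i).trans inter_subset_left) ((hCB j).trans inter_subset_left)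
  obtain ⟨V, hV, hVd⟩ := hCd.exists_mem_filter s.finite_toSet
  set U : ι → Set (E N) := fun i => interior (V i) ∩ (A i ∩ O i) with hU
  have hUo : ∀ i, IsOpen (U i) := fun i => isOpen_interior.inter ((hA i).inter (hO i))
  have hCU : ∀ i, C i ⊆ U i := fun i => subset_inter (subset_interior_iff_mem_nhdsSet.2 (hV i))
    (subset_inter ((hCB i).trans (inter_subset_left.trans (hBA i))) (hCO i))
  choose f hf0 hf1 hf using fun i => exists_bounded_zero_one_of_closed (hUo i).isClosed_compl
    (hC i).isClosed (disjoint_compl_left_iff_subset.2 (hCU i))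
  refine ⟨U, f, hUo, fun i => inter_subset_right.trans inter_subset_left, fun i hi j hj hij =>
    (hVd hi hj hij).mono (inter_subset_left.trans interior_subset)
      (inter_subset_left.trans interior_subset), hf, hf0, fun i => ?_⟩
  calc pos u (B i) ≤ pos u (B i ∩ P) + pos u (B i \ P) := measure_le_inter_add_sdiff _ _ _
    _ = pos u (B i ∩ P) := by
        rw [measure_mono_null (fun x hx => hx.2 : B i \ P ⊆ Pᶜ) hPpos, add_zero]
    _ ≤ pos u (C i) + δ := (hCδ i).le
    _ ≤ ENNReal.ofReal (∫ᵛ x, f i x ∂<•u) + neg u (U i) + δ := by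
        gcongr
        exact pos_le_ofReal_integral_add u (f i) (hC i).measurableSet (hUo i).measurableSet
          (hf i) (hf0 i) (hf1 i)
    _ ≤ ENNReal.ofReal (∫ᵛ x, f i x ∂<•u) + δ + δ := by
        gcongr
        exact (measure_mono (inter_subset_right.trans inter_subset_right)).trans (hOδ i).le
    _ = _ := add_assoc _ _ _

theorem IsRayConcave.sum_le_liminf_posMass {K : E N × ℝ → ℝ≥0∞} (hK : IsRayConcave K)
    {v : ℕ → SignedMeasure (E N)} {u : SignedMeasure (E N)} (hv : NarrowTendsto v u)
    {ι : Type*} (s : Finset ι) {A B : ι → Set (E N)} (hA : ∀ i, IsOpen (A i))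
    (hB : ∀ i, MeasurableSet (B i)) (hBA : ∀ i, B i ⊆ A i) (hd : (s : Set ι).PairwiseDisjoint B)
    (c : ι → ℝ≥0) (t : ι → ℝ) (ht : ∀ i, pos u (A i) < ENNReal.ofReal (t i))
    (hc : ∀ i, ∀ y ∈ A i, c i * ENNReal.ofReal (t i) ≤ K (y, t i)) :
    ∑ i ∈ s, c i * pos u (B i) ≤ liminf (fun n => posMass K (pos (v n)) univ) atTop := by
  have ht0 : ∀ i, 0 < t i := fun i => by simpa using (zero_le).trans_lt (ht i)
  refine ENNReal.le_of_forall_pos_le_add fun ε hε _ => ?_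
  set S : ℝ≥0 := ∑ i ∈ s, c i with hS
  -- The total error is S·2δ; the +1 covers S = 0.
  set δ : ℝ≥0 := ε / (2 * (S + 1)) with hδ
  have hδ0 : (δ : ℝ≥0∞) ≠ 0 := by
    have : 0 < δ := by positivity
    exact_mod_cast this.ne'
  have hSδ : S * (δ + δ) ≤ ε := by
    rw [← NNReal.coe_le_coe]
    have h : (δ : ℝ) * (2 * (S + 1)) = ε := by
      rw [hδ]; push_cast; field_simp
    have : (0 : ℝ) ≤ δ := δ.2
    push_cast
    nlinarith
  obtain ⟨U, f, hU, hUA, hUd, hf, hfU, hfB⟩ :=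
    exists_separating_functions u s hA hB hBA hd hδ0
  have hlim : ∑ i ∈ s, (c i : ℝ≥0∞) * ENNReal.ofReal (∫ᵛ x, f i x ∂<•u)
      ≤ liminf (fun n => posMass K (pos (v n)) univ) atTop := by
    have htend : Tendsto (fun n => ∑ i ∈ s, (c i : ℝ≥0∞) *
        min (ENNReal.ofReal (∫ᵛ x, f i x ∂<•(v n))) (ENNReal.ofReal (t i))) atTop
        (𝓝 (∑ i ∈ s, (c i : ℝ≥0∞) * ENNReal.ofReal (∫ᵛ x, f i x ∂<•u))) := by
      refine tendsto_finsetSum s fun i _ => ENNReal.Tendsto.const_mul ?_ (Or.inr ENNReal.coe_ne_top)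
      -- This is where t exceeding the mass of A matters: the minimum with t disappears in the
      -- limit.
      have h1 : ENNReal.ofReal (∫ᵛ x, f i x ∂<•u) ≤ ENNReal.ofReal (t i) :=
        ((ofReal_integral_le_pos u (f i) (hU i).measurableSet (hf i) (hfU i)).trans
          (measure_mono (hUA i))).trans (ht i).le
      have h2 := (ENNReal.tendsto_ofReal (hv (f i))).min
        (tendsto_const_nhds (x := ENNReal.ofReal (t i)))
      rwa [min_eq_left h1] at h2
    rw [← htend.liminf_eq]
    refine liminf_le_liminf (Eventually.of_forall fun n => ?_)
    calc ∑ i ∈ s, (c i : ℝ≥0∞) *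
          min (ENNReal.ofReal (∫ᵛ x, f i x ∂<•(v n))) (ENNReal.ofReal (t i))
        ≤ ∑ i ∈ s, posMass K (pos (v n)) (U i) := by
          refine Finset.sum_le_sum fun i _ => le_trans ?_ (hK.mul_min_le_posMass (pos (v n))
            (hU i).measurableSet (ht0 i) fun y hy => hc i y (hUA i hy))
          gcongr
          exact ofReal_integral_le_pos (v n) (f i) (hU i).measurableSet (hf i) (hfU i)
      _ = posMass K (pos (v n)) (⋃ i ∈ s, U i) :=
          (measure_biUnion_finset hUd fun i _ => (hU i).measurableSet).symm
      _ ≤ posMass K (pos (v n)) univ := measure_mono (subset_univ _)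
  calc ∑ i ∈ s, (c i : ℝ≥0∞) * pos u (B i)
      ≤ ∑ i ∈ s, ((c i : ℝ≥0∞) * ENNReal.ofReal (∫ᵛ x, f i x ∂<•u) + c i * (δ + δ)) := by
        refine Finset.sum_le_sum fun i _ => ?_
        rw [← mul_add]
        gcongr
        exact hfB i
    _ = ∑ i ∈ s, (c i : ℝ≥0∞) * ENNReal.ofReal (∫ᵛ x, f i x ∂<•u) + (S * (δ + δ) : ℝ≥0) := by
        rw [Finset.sum_add_distrib, ← Finset.sum_mul, hS]
        push_cast
        rfl
    _ ≤ _ := add_le_add hlim (by exact_mod_cast hSδ)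

/-- A basic open set `A` is adapted to the slope `c` if `K (·, t) ≥ c t` on `A` for some mass `t`
larger than the mass of `A`. -/
def IsAdapted (K : E N × ℝ → ℝ≥0∞) (μ : Measure (E N)) (c : ℝ≥0) (A : Set (E N)) : Prop :=
  ∃ t : ℝ, μ A < ENNReal.ofReal t ∧ ∀ y ∈ A, c * ENNReal.ofReal t ≤ K (y, t)

theorem exists_isAdapted {K : E N × ℝ → ℝ≥0∞} (hlsc : LowerSemicontinuous K) (μ : Measure (E N))
    [IsFiniteMeasure μ] {x : E N} {c : ℝ≥0} {t : ℝ} (ht : μ {x} < ENNReal.ofReal t)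
    (hc : c * ENNReal.ofReal t < K (x, t)) :
    ∃ A ∈ TopologicalSpace.countableBasis (E N), x ∈ A ∧ IsAdapted K μ c A := by
  obtain ⟨U, hxU, hU, hUt⟩ := Set.exists_isOpen_lt_of_lt {x} _ ht
  have hcont : Continuous fun y : E N => (y, t) := by fun_prop
  have hev : ∀ᶠ y in 𝓝 x, c * ENNReal.ofReal t < K (y, t) := (hlsc.comp hcont) x _ hc
  obtain ⟨A, hA, hxA, hAV⟩ := (TopologicalSpace.isBasis_countableBasis (E N)).mem_nhds_iff.1
    (inter_mem (hU.mem_nhds (singleton_subset_iff.1 hxU)) hev)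
  exact ⟨A, hA, hxA, t, (measure_mono fun y hy => (hAV hy).1).trans_lt hUt,
    fun y hy => (hAV hy).2.le⟩

/-- Above the mass of an atom there are slightly larger masses with almost the same slope. -/
theorem exists_mul_lt_of_mul_lt {K : E N × ℝ → ℝ≥0∞} (hlsc : LowerSemicontinuous K) {x : E N}
    {c : ℝ≥0} {m : ℝ} (h : c * ENNReal.ofReal m < K (x, m)) :
    ∃ t, m < t ∧ c * ENNReal.ofReal t < K (x, t) := by
  obtain ⟨d, hd1, hd2⟩ := exists_between h
  have hcont : Continuous fun t : ℝ => (x, t) := by fun_prop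
  have h1 : ∀ᶠ t in 𝓝 m, d < K (x, t) := (hlsc.comp hcont) m _ hd2
  have h2 : ∀ᶠ t in 𝓝 m, c * ENNReal.ofReal t < d :=
    ((ENNReal.continuous_const_mul ENNReal.coe_ne_top).comp
      ENNReal.continuous_ofReal).continuousAt.eventually_lt continuousAt_const hd1
  obtain ⟨t, ⟨ht1, ht2⟩, hmt⟩ := (((h1.and h2).filter_mono nhdsWithin_le_nhds).and
    (self_mem_nhdsWithin (a := m) (s := Ioi m))).exists
  exact ⟨t, hmt, ht2.trans ht1⟩

/-- At an atom, lower semicontinuity in the mass lets t be taken slightly above μ{x} with the same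
c; at other points every t > 0 is allowed, and the supremum of the slopes is the right slope. -/
theorem IsRayConcave.posMass_le_lintegral {K : E N × ℝ → ℝ≥0∞} (hK : IsRayConcave K)
    (μ : Measure (E N)) [IsFiniteMeasure μ] {ψ : E N → ℝ≥0∞}
    (hψ : ∀ x (t : ℝ) (c : ℝ≥0), μ {x} < ENNReal.ofReal t → c * ENNReal.ofReal t < K (x, t) →
      c ≤ ψ x) (hlsc : LowerSemicontinuous K) :
    posMass K μ univ ≤ ∫⁻ x, ψ x ∂μ := by
  rw [posMass_apply _ _ MeasurableSet.univ, ← setLIntegral_univ ψ,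
    setLIntegral_eq_atoms_add μ ψ MeasurableSet.univ]
  refine add_le_add (lintegral_mono fun x => ?_) ?_
  · rcases eq_or_ne (μ {x}) 0 with h0 | h0
    · simp [measureReal_def, h0, hK.zero]
    · rw [← ENNReal.div_le_iff h0 (measure_ne_top _ _)]
      refine ENNReal.le_of_forall_nnreal_lt fun c hc => ?_
      rw [ENNReal.lt_div_iff_mul_lt (Or.inl h0) (Or.inl (measure_ne_top _ _)),
        ← ofReal_measureReal (μ := μ) (s := {x})] at hc
      obtain ⟨t, hmt, ht⟩ := exists_mul_lt_of_mul_lt hlsc hc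
      refine hψ x t c ?_ ht
      rw [← ofReal_measureReal (μ := μ) (s := {x})]
      exact (ENNReal.ofReal_lt_ofReal_iff (measureReal_nonneg.trans_lt hmt)).2 hmt
  · rw [Measure.restrict_univ]
    refine setLIntegral_mono' (measurableSet_singleton_null μ) fun x hx => ?_
    refine ENNReal.le_of_forall_nnreal_lt fun c hc => ?_
    obtain ⟨t, ht0, ht⟩ := hK.exists_mul_lt_of_lt_rightSlope hc
    have hx : μ {x} = 0 := hx
    exact hψ x t c (by simpa [hx] using ht0) ht

theorem IsRayConcave.posMass_le_liminf {K : E N × ℝ → ℝ≥0∞} (hK : IsRayConcave K)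
    (hlsc : LowerSemicontinuous K) {v : ℕ → SignedMeasure (E N)} {u : SignedMeasure (E N)}
    (hv : NarrowTendsto v u) :
    posMass K (pos u) univ ≤ liminf (fun n => posMass K (pos (v n)) univ) atTop := by
  -- Rational slopes and a countable basis keep the supremum of step functions countable, as
  -- monotone convergence requires.
  let Q : Set (ℚ × Set (E N)) :=
    {q | q.2 ∈ TopologicalSpace.countableBasis (E N) ∧
      IsAdapted K (pos u) (Real.toNNReal q.1) q.2}
  have hQ : Q.Countable :=
    ((countable_univ (α := ℚ)).prod (TopologicalSpace.countable_countableBasis (E N))).mono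
      fun q hq => mk_mem_prod (mem_univ _) hq.1
  have : Countable Q := hQ.to_subtype
  let c : Q → ℝ≥0 := fun q => Real.toNNReal q.1.1
  let A : Q → Set (E N) := fun q => q.1.2
  have hA : ∀ q, IsOpen (A q) := fun q => TopologicalSpace.isOpen_of_mem_countableBasis q.2.1
  choose t ht hc using fun q : Q => q.2.2
  refine (hK.posMass_le_lintegral (pos u)
    (ψ := fun x => ⨆ q, (A q).indicator (fun _ => (c q : ℝ≥0∞)) x) ?_ hlsc).trans ?_
  · intro x t c hxt hct
    refine le_of_forall_lt fun d hd => ?_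
    obtain ⟨r, -, hdr, hrc⟩ := ENNReal.lt_iff_exists_rat_btwn.1 hd
    obtain ⟨B, hB, hxB, hBad⟩ := exists_isAdapted hlsc (pos u) (c := Real.toNNReal r) hxt
      (lt_of_le_of_lt (by gcongr) hct)
    let q : Q := ⟨(r, B), hB, hBad⟩
    refine hdr.trans_le (le_iSup_of_le q ?_)
    rw [indicator_of_mem (show x ∈ A q from hxB)]
  · refine le_of_forall_lt fun M hM => ?_
    obtain ⟨s, B, hB, hBA, hBd, hlt⟩ :=
      exists_disjoint_lt_sum_of_lt_lintegral_iSup c (fun q => (hA q).measurableSet) hM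
    exact hlt.trans_le (hK.sum_le_liminf_posMass hv s hA hB hBA hBd c t ht hc)

theorem NarrowTendsto.neg {v : ℕ → SignedMeasure (E N)} {u : SignedMeasure (E N)}
    (h : NarrowTendsto v u) : NarrowTendsto (fun n => -v n) (-u) := by
  intro f
  simpa only [VectorMeasure.integral_neg_vectorMeasure] using (h f).neg

theorem IsRayConcave.seqNarrowLsc_massH {K : E N × ℝ → ℝ≥0∞} (hK : IsRayConcave K)
    (hlsc : LowerSemicontinuous K) : SeqNarrowLsc (massH K) := by
  intro v u h
  simp only [massH_eq_posMass hK]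
  exact (add_le_add (hK.posMass_le_liminf hlsc h)
    (hK.reflect.posMass_le_liminf (lowerSemicontinuous_reflect hlsc) h.neg)).trans
    (liminf_add_liminf_le atTop _ _)

/-- On finitely atomic measures the mass is at most the atomic functional. -/
theorem IsRayConcave.massH_le_massAtom {K H : E N × ℝ → ℝ≥0∞} (hK : IsRayConcave K) (hKH : K ≤ H) :
    massH K ≤ massAtom H := by
  intro u
  refine le_iInf fun s => le_iInf fun m => le_iInf fun hu => ?_
  have hd : diffusePart u = 0 := by
    ext B hB
    rw [diffusePart, VectorMeasure.restrict_apply _ (measurableSet_atoms u).compl hB, hu,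
      _root_.sum_apply]
    refine Finset.sum_eq_zero fun x hx => ?_
    by_cases hxB : x ∈ B ∩ (atoms (∑ x ∈ s, VectorMeasure.dirac x (m x)))ᶜ
    · have : m x = 0 := by
        have := hxB.2
        rw [atoms, mem_compl_iff, mem_ofPred_eq, not_not, sum_dirac_singleton,
          indicator_of_mem (by simpa using hx)] at this
        exact this
      simp [this]
    · exact VectorMeasure.dirac_apply_of_notMem hxB
  rw [massH, hd]
  simp only [SignedMeasure.toJordanDecomposition_zero, JordanDecomposition.zero_posPart,
    JordanDecomposition.zero_negPart, lintegral_zero_measure, add_zero, lintegral_count]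
  rw [tsum_eq_sum (s := s)]
  · refine Finset.sum_le_sum fun x hx => ?_
    rw [hu, sum_dirac_singleton, indicator_of_mem (by simpa using hx)]
    exact hKH _
  · intro x hx
    rw [hu, sum_dirac_singleton, indicator_of_notMem (by simpa using hx), hK.zero]

/-! ### Narrow convergence -/

theorem NarrowTendsto.add {v w : ℕ → SignedMeasure (E N)} {u z : SignedMeasure (E N)}
    (h : NarrowTendsto v u) (h' : NarrowTendsto w z) :
    NarrowTendsto (fun n => v n + w n) (u + z) := by
  intro f
  simp only [VectorMeasure.integral_add_vectorMeasure (integrable_boundedContinuous _ f)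
    (integrable_boundedContinuous _ f)]
  exact (h f).add (h' f)

theorem integral_sum_dirac {ι : Type*} (s : Finset ι) (x : ι → E N) (m : ι → ℝ) (f : E N →ᵇ ℝ) :
    ∫ᵛ y, f y ∂<•(∑ i ∈ s, VectorMeasure.dirac (x i) (m i)) = ∑ i ∈ s, m i * f (x i) := by
  rw [VectorMeasure.integral_finsetSum_vectorMeasure fun i _ => integrable_boundedContinuous _ f]
  refine Finset.sum_congr rfl fun i _ => ?_
  rw [VectorMeasure.integral_dirac]
  simp

/-! ### From a function to its lower semicontinuous envelope -/

theorem exists_seq_tendsto_le_lscEnvelope (H : E N × ℝ → ℝ≥0∞) (p : E N × ℝ) :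
    ∃ q : ℕ → E N × ℝ, Tendsto q atTop (𝓝 p) ∧
      ∀ n, H (q n) ≤ lscEnvelope H p + ((n : ℝ≥0∞) + 1)⁻¹ := by
  rcases eq_or_ne (lscEnvelope H p) ⊤ with htop | htop
  · exact ⟨fun _ => p, tendsto_const_nhds, fun n => by simp [htop]⟩
  have hlt : ∀ n : ℕ, lscEnvelope H p < lscEnvelope H p + ((n : ℝ≥0∞) + 1)⁻¹ := fun n =>
    ENNReal.lt_add_right htop (by simp [ENNReal.add_eq_top])
  have hex : ∀ n : ℕ, ∃ q, H q < lscEnvelope H p + ((n : ℝ≥0∞) + 1)⁻¹ ∧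
      dist q p < 1 / ((n : ℝ) + 1) := fun n =>
    ((frequently_lt_of_lscEnvelope_lt (hlt n)).and_eventually
      (Metric.ball_mem_nhds p (by positivity))).exists
  choose q hq hqp using hex
  refine ⟨q, tendsto_iff_dist_tendsto_zero.2 ?_, fun n => (hq n).le⟩
  exact squeeze_zero (fun n => dist_nonneg) (fun n => (hqp n).le)
    tendsto_one_div_add_atTop_nhds_zero_nat

theorem IsRayConcave.le_massAtom_lscEnvelope {H : E N × ℝ → ℝ≥0∞} (hH : IsRayConcave H)
    {F : SignedMeasure (E N) → ℝ≥0∞} (hF : SeqNarrowLsc F) (hFH : F ≤ massAtom H) :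
    F ≤ massAtom (HMass.lscEnvelope H) := by
  intro u
  refine le_iInf fun s => le_iInf fun m => le_iInf fun hu => ?_
  choose q hq hqH using fun x : E N => exists_seq_tendsto_le_lscEnvelope H (x, m x)
  set v : ℕ → SignedMeasure (E N) := fun n =>
    ∑ x ∈ s, VectorMeasure.dirac (q x n).1 (q x n).2 with hv
  have hvu : NarrowTendsto v u := by
    intro f
    simp only [hv, hu, integral_sum_dirac]
    refine tendsto_finsetSum s fun x _ => ?_
    exact (hq x).snd_nhds.mul ((f.continuous.tendsto x).comp (hq x).fst_nhds)
  have hbound : ∀ n, F (v n) ≤ ∑ x ∈ s, (HMass.lscEnvelope H (x, m x) + ((n : ℝ≥0∞) + 1)⁻¹) :=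
    fun n => ((hFH _).trans (hH.massAtom_sum_dirac_le s _ _)).trans
      (Finset.sum_le_sum fun x _ => hqH x n)
  have hlim : Tendsto (fun n : ℕ => ∑ x ∈ s, (HMass.lscEnvelope H (x, m x) + ((n : ℝ≥0∞) + 1)⁻¹))
      atTop (𝓝 (∑ x ∈ s, (HMass.lscEnvelope H (x, m x) + 0))) := by
    refine tendsto_finsetSum s fun x _ => tendsto_const_nhds.add ?_
    simpa using (tendsto_add_atTop_iff_nat 1).2 ENNReal.tendsto_inv_nat_nhds_zero
  calc F u ≤ liminf (fun n => F (v n)) atTop := hF v u hvu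
    _ ≤ _ := liminf_le_liminf (Eventually.of_forall hbound)
    _ = _ := hlim.liminf_eq
    _ = _ := by simp

/-! ### Approximation by finitely atomic measures -/

/-- `u` is a narrow limit of finitely atomic measures of `K`-mass at most `c`. -/
def AtomApprox (K : E N × ℝ → ℝ≥0∞) (u : SignedMeasure (E N)) (c : ℝ≥0∞) : Prop :=
  ∃ v : ℕ → SignedMeasure (E N), NarrowTendsto v u ∧ ∀ n, massAtom K (v n) ≤ c

theorem AtomApprox.add {K : E N × ℝ → ℝ≥0∞} (hK : IsRayConcave K) {u v : SignedMeasure (E N)}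
    {c d : ℝ≥0∞} (hu : AtomApprox K u c) (hv : AtomApprox K v d) : AtomApprox K (u + v) (c + d) := by
  obtain ⟨u', hu', huc⟩ := hu
  obtain ⟨v', hv', hvd⟩ := hv
  exact ⟨_, hu'.add hv', fun n => (hK.massAtom_add_le _ _).trans (add_le_add (huc n) (hvd n))⟩

theorem AtomApprox.neg {K : E N × ℝ → ℝ≥0∞} {u : SignedMeasure (E N)} {c : ℝ≥0∞}
    (hu : AtomApprox (reflect K) u c) : AtomApprox K (-u) c := by
  obtain ⟨v, hv, hc⟩ := hu
  exact ⟨_, hv.neg, fun n => (massAtom_neg_le K _).trans (hc n)⟩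

theorem hasSum_integral_restrict_atoms (u : SignedMeasure (E N)) (f : E N →ᵇ ℝ) :
    HasSum (fun x : atoms u => u {(x : E N)} * f x) (∫ᵛ x, f x ∂<•(u.restrict (atoms u))) := by
  have hcount : Countable (atoms u) := (countable_atoms u).to_subtype
  have key : ∀ (μ : Measure (E N)) [IsFiniteMeasure μ],
      HasSum (fun x : atoms u => μ.real {(x : E N)} * f x) (∫ x in atoms u, f x ∂μ) := by
    intro μ _
    have h := hasSum_integral_iUnion (μ := μ) (f := f) (s := fun x : atoms u => {(x : E N)})
      (fun x => measurableSet_singleton _)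
      (fun x y hxy => by simpa [Function.onFun, Subtype.coe_inj] using hxy)
      (f.integrable μ).integrableOn
    simpa [iUnion_of_singleton_coe, integral_singleton, measureReal_def] using h
  have hJ := toJordanDecomposition_restrict u (measurableSet_atoms u)
  rw [integral_eq_pos_sub_neg, hJ.1, hJ.2]
  simpa only [apply_singleton, sub_mul] using (key (pos u)).sub (key (HMass.neg u))

theorem IsRayConcave.atomApprox_restrict_atoms {K : E N × ℝ → ℝ≥0∞} (hK : IsRayConcave K)
    (u : SignedMeasure (E N)) :
    AtomApprox K (u.restrict (atoms u)) (∫⁻ x, K (x, u {x}) ∂Measure.count) := by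
  have hcount : Countable (atoms u) := (countable_atoms u).to_subtype
  -- Unconditional summability over the atoms is turned into convergence along a sequence of finite
  -- sets.
  obtain ⟨T, hT⟩ := exists_seq_tendsto (atTop : Filter (Finset (atoms u)))
  refine ⟨fun n => ∑ x ∈ T n, VectorMeasure.dirac (x : E N) (u {(x : E N)}), fun f => ?_,
    fun n => ?_⟩
  · simp only [integral_sum_dirac]
    exact (hasSum_integral_restrict_atoms u f).comp hT
  · rw [lintegral_count]
    exact (hK.massAtom_sum_dirac_le _ _ _).trans ((ENNReal.sum_le_tsum (T n)).trans
      (ENNReal.tsum_comp_le_tsum_of_injective Subtype.val_injective fun x => K (x, u {x})))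

/-- A finite measure can be split, up to a small remainder, into finitely many cells of small
diameter, with points in the cells where `g` does not exceed its mean value. -/
theorem exists_cells (μ : Measure (E N)) [IsFiniteMeasure μ] {g : E N → ℝ≥0∞} (hg : Measurable g)
    {r : ℝ} (hr : 0 < r) {η : ℝ≥0∞} (hη : η ≠ 0) :
    ∃ (n : ℕ) (x : ℕ → E N) (A : ℕ → Set (E N)) (R : Set (E N)), (∀ j, MeasurableSet (A j)) ∧
      Pairwise (Function.onFun Disjoint A) ∧ (∀ z ∉ R, ∃ j < n, z ∈ A j) ∧ μ R ≤ η ∧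
      (∀ j, ∀ z ∈ A j, dist (x j) z ≤ r + r) ∧
      ∑ j ∈ Finset.range n, g (x j) * μ (A j) ≤ ∫⁻ z, g z ∂μ := by
  set e := TopologicalSpace.denseSeq (E N) with he
  set A : ℕ → Set (E N) := disjointed fun j => Metric.ball (e j) r with hA
  have hAm : ∀ j, MeasurableSet (A j) := MeasurableSet.disjointed fun j => measurableSet_ball
  have hAd : Pairwise (Function.onFun Disjoint A) := disjoint_disjointed _
  have hAr : ∀ j, A j ⊆ Metric.ball (e j) r := fun j => disjointed_subset _ j
  have hAU : ⋃ j, A j = univ := by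
    rw [hA, iUnion_disjointed, eq_univ_iff_forall]
    intro z
    obtain ⟨j, hj⟩ := (TopologicalSpace.denseRange_denseSeq (E N)).exists_dist_lt z hr
    exact mem_iUnion.2 ⟨j, hj⟩
  have hx : ∀ j, ∃ x ∈ Metric.ball (e j) r, g x * μ (A j) ≤ ∫⁻ z in A j, g z ∂μ := by
    intro j
    rcases eq_or_ne (μ (A j)) 0 with h0 | h0
    · exact ⟨e j, Metric.mem_ball_self hr, by simp [h0]⟩
    -- The mean-value choice makes the weighted sum of g a lower bound for its integral, without any
    -- continuity of g.
    · obtain ⟨x, hx, hgx⟩ := exists_le_setLAverage h0 (measure_ne_top _ _) hg.aemeasurable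
      refine ⟨x, hAr j hx, ?_⟩
      rwa [setLAverage_eq, ENNReal.le_div_iff_mul_le (Or.inl h0) (Or.inl (measure_ne_top _ _))]
        at hgx
  choose x hxr hxg using hx
  have htend := tendsto_measure_biUnion_Ici_zero_of_pairwise_disjoint (μ := μ)
    (fun j => (hAm j).nullMeasurableSet) hAd
  obtain ⟨n, hn⟩ := (htend.eventually (gt_mem_nhds (pos_iff_ne_zero.2 hη))).exists
  refine ⟨n, x, A, ⋃ j ≥ n, A j, hAm, hAd, fun z hz => ?_, hn.le, fun j z hz => ?_, ?_⟩
  · obtain ⟨j, hj⟩ := mem_iUnion.1 (hAU ▸ mem_univ z)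
    refine ⟨j, ?_, hj⟩
    by_contra! h
    exact hz (mem_biUnion h hj)
  · exact (dist_triangle_right _ _ (e j)).trans (add_le_add (hxr j).le (hAr j hz).le)
  · calc ∑ j ∈ Finset.range n, g (x j) * μ (A j) ≤ ∑ j ∈ Finset.range n, ∫⁻ z in A j, g z ∂μ :=
          Finset.sum_le_sum fun j _ => hxg j
      _ ≤ ∑' j, ∫⁻ z in A j, g z ∂μ := ENNReal.sum_le_tsum _
      _ = ∫⁻ z, g z ∂μ := by rw [← lintegral_iUnion hAm hAd, hAU, setLIntegral_univ]

/-- Each cell's mass is concentrated at a point where the slope is at most its mean. There K(x,m) ≤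
K'(x,0⁺)m, so the cost is at most the integral of the slope. -/
theorem IsRayConcave.atomApprox_toSignedMeasure {K : E N × ℝ → ℝ≥0∞} (hK : IsRayConcave K)
    (hlsc : LowerSemicontinuous K) (μ : Measure (E N)) [IsFiniteMeasure μ] :
    AtomApprox K μ.toSignedMeasure (∫⁻ x, rightSlope K x ∂μ) := by
  have hm : Measurable (rightSlope K) := (hK.lowerSemicontinuous_rightSlope hlsc).measurable
  -- Remainders of mass at most 2⁻ᵏ are summable, so by Borel–Cantelli almost every point eventually
  -- lies in a cell; the step functions `G k` then converge to f almost everywhere.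
  choose n x A R hAm hAd hAR hR hxA hsum using fun k : ℕ =>
    exists_cells μ hm (r := 1 / ((k : ℝ) + 1)) (by positivity) (η := (2 : ℝ≥0∞)⁻¹ ^ k)
      (by simp)
  refine ⟨fun k => ∑ j ∈ Finset.range (n k), VectorMeasure.dirac (x k j) (μ.real (A k j)),
    fun f => ?_, fun k => ?_⟩
  · set G : ℕ → E N → ℝ := fun k z =>
      ∑ j ∈ Finset.range (n k), (A k j).indicator (fun _ => f (x k j)) z with hG
    have hGint : ∀ k, ∫ z, G k z ∂μ = ∑ j ∈ Finset.range (n k), μ.real (A k j) * f (x k j) := by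
      intro k
      rw [integral_finsetSum _ fun j _ => (integrable_const _).indicator (hAm k j)]
      exact Finset.sum_congr rfl fun j _ => by rw [integral_indicator_const _ (hAm k j), smul_eq_mul]
    have hGmem : ∀ k z j, j < n k → z ∈ A k j → G k z = f (x k j) := by
      intro k z j hj hz
      rw [hG]
      dsimp only
      rw [Finset.sum_eq_single_of_mem j (Finset.mem_range.2 hj), indicator_of_mem hz]
      intro i _ hij
      exact indicator_of_notMem (disjoint_right.1 (hAd k hij) hz) _
    simp only [integral_sum_dirac, VectorMeasure.integral_toSignedMeasure, ← hGint]
    refine tendsto_integral_of_dominated_convergence (fun _ => ‖f‖)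
      (fun k => (Finset.measurable_sum _ fun j _ =>
        measurable_const.indicator (hAm k j)).aestronglyMeasurable)
      (integrable_const _) (fun k => Eventually.of_forall fun z => ?_) ?_
    · by_cases h : ∃ j < n k, z ∈ A k j
      · obtain ⟨j, hj, hz⟩ := h
        rw [hGmem k z j hj hz]
        exact f.norm_coe_le_norm _
      · push Not at h
        have : G k z = 0 :=
          Finset.sum_eq_zero fun j hj => indicator_of_notMem (h j (Finset.mem_range.1 hj)) _
        simp [this]
    · have hfin : ∑' k, μ (R k) ≠ ⊤ := by
        refine ((ENNReal.tsum_le_tsum hR).trans_lt ?_).ne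
        rw [ENNReal.tsum_geometric]
        simp
      filter_upwards [ae_eventually_notMem hfin] with z hz
      refine Metric.tendsto_nhds.2 fun ε hε => ?_
      obtain ⟨δ, hδ, hδf⟩ := Metric.continuousAt_iff.1 (f.continuous.continuousAt (x := z)) ε hε
      have hsmall : ∀ᶠ k : ℕ in atTop, 1 / ((k : ℝ) + 1) < δ / 2 :=
        tendsto_one_div_add_atTop_nhds_zero_nat.eventually (gt_mem_nhds (half_pos hδ))
      filter_upwards [hz, hsmall] with k hk hkδ
      obtain ⟨j, hj, hzj⟩ := hAR k z hk
      rw [hGmem k z j hj hzj]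
      exact hδf ((hxA k j z hzj).trans_lt (by linarith))
  · refine (hK.massAtom_sum_dirac_le _ _ _).trans (le_trans (Finset.sum_le_sum fun j _ => ?_)
      (hsum k))
    have := hK.le_rightSlope_mul (x k j) (m := μ.real (A k j)) measureReal_nonneg
    rwa [ofReal_measureReal] at this

theorem IsRayConcave.atomApprox_massH {K : E N × ℝ → ℝ≥0∞} (hK : IsRayConcave K)
    (hlsc : LowerSemicontinuous K) (u : SignedMeasure (E N)) : AtomApprox K u (massH K u) := by
  have h := ((hK.atomApprox_restrict_atoms u).add hK
    (hK.atomApprox_toSignedMeasure hlsc (pos (diffusePart u)))).add hK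
    (hK.reflect.atomApprox_toSignedMeasure (lowerSemicontinuous_reflect hlsc)
      (HMass.neg (diffusePart u))).neg
  have hu : u.restrict (atoms u) + (pos (diffusePart u)).toSignedMeasure
      + -(HMass.neg (diffusePart u)).toSignedMeasure = u := by
    rw [add_assoc, ← sub_eq_add_neg, pos_sub_neg, diffusePart,
      VectorMeasure.restrict_add_restrict_compl (measurableSet_atoms u)]
  rw [hu] at h
  simpa only [massH, hK.leftSlope_eq] using h

theorem IsRayConcave.le_massH_of_le_massAtom {K : E N × ℝ → ℝ≥0∞} (hK : IsRayConcave K)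
    (hlsc : LowerSemicontinuous K) {F : SignedMeasure (E N) → ℝ≥0∞} (hF : SeqNarrowLsc F)
    (hFK : F ≤ massAtom K) : F ≤ massH K := by
  intro u
  obtain ⟨v, hv, hc⟩ := hK.atomApprox_massH hlsc u
  calc F u ≤ liminf (fun n => F (v n)) atTop := hF v u hv
    _ ≤ liminf (fun _ : ℕ => massH K u) atTop :=
        liminf_le_liminf (Eventually.of_forall fun n => (hFK _).trans (hc n))
    _ = massH K u := liminf_const _

end HMass

end

theorem mainTheorem6 {N : ℕ} (H : HMass.E N × ℝ → ℝ≥0∞) (hconc : HMass.MassConcave H)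
    (hzero : ∀ x, H (x, 0) = 0) :
    HMass.IsAdmissible (HMass.lscEnvelope H) ∧
      HMass.massH (HMass.lscEnvelope H) = HMass.seqNarrowLscEnvelope (HMass.massAtom H) := by
  have hH := hconc.isRayConcave hzero
  have hK := hH.lscEnvelope
  have hlsc := HMass.lowerSemicontinuous_lscEnvelope H
  refine ⟨hK.isAdmissible hlsc, le_antisymm ?_ ?_⟩
  · exact le_sSup ⟨hK.massH_le_massAtom (HMass.lscEnvelope_le H), hK.seqNarrowLsc_massH hlsc⟩
  · exact sSup_le fun F hF => hK.le_massH_of_le_massAtom hlsc hF.2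
      (hH.le_massAtom_lscEnvelope hF.2 hF.1)
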